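/- Let $\Gamma$ be a totally ordered abelian group with positive cone $\Gamma^+=\{x\in\Gamma: x\ge 0\}$ and let $\mathcal A$ be a unital $C^*$-algebra with center $Z(\mathcal A)$. An action of $\Gamma^+$ on $\mathcal A$ is a family $\mathcal V=(\mathcal V_x)_{x\in\Gamma^+}$ of positive linear maps $\mathcal V_x:\mathcal A\to\mathcal A$ with $\mathcal V_0=\mathrm{Id}$ and $\mathcal V_{x+y}=\mathcal V_x\circ\mathcal V_y$ for all $x,y\in\Gamma^+$. A pair $(\mathcal V,\mathcal H)$ of such actions is an interaction if for every $x\in\Gamma^+$: $\mathcal V_x\mathcal H_x\mathcal V_x=\mathcal V_x$; $\mathcal H_x\mathcal V_x\mathcal H_x=\mathcal H_x$; $\mathcal V_x(ab)=\mathcal V_x(a)\mathcal V_x(b)$ whenever $a$ or $b$ lies in $\mathcal H_x(\mathcal A)$; and $\mathcal H_x(ab)=\mathcal H_x(a)\mathcal H_x(b)$ whenever $a$ or $b$ lies in $\mathcal V_x(\mathcal A)$. It is complete if moreover, for all $x,y\in\Gamma^+$ and $a\in\mathcal A$, $$\mathcal H_x(\mathcal V_x(a))=\mathcal H_x(1)a\mathcal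 H_x(1),\qquad \mathcal V_x(\mathcal H_x(a))=\mathcal V_x(1)a\mathcal V_x(1),\qquad \mathcal H_y(1)\mathcal V_x(1)=\mathcal V_x(1)\mathcal H_y(1).$$ An action $\mathcal V$ is finely representable if there are a unital $C^*$-algebra $C$, an injective unital $*$-homomorphism $\sigma:\mathcal A\to C$ and a semigroup homomorphism $U:\Gamma^+\to C$ (so $U_{x+y}=U_xU_y$) such that every $U_x$ is a partial isometry and, for all $x\in\Gamma^+$ and $a\in\mathcal A$, $$\sigma(\mathcal V_x(a))=U_x\sigma(a)U_x^*,\qquad U_x^*\sigma(a)U_x\in\sigma(\mathcal A).$$ **Theorem.** Let $(\mathcal V,\mathcal H)$ be a complete interaction. Then the following conditions are equivalent: i) each $\mathcal V_x$, $x\in\Gamma^+$, is a (not necessarily unital) $*$-endomorphism of $\mathcal A$; ii) $\mathcal H_x(1)\in Z(\mathcal A)$ for all $x\in\Gamma^+$; iii) $(\mathcal A,\Gamma^+,\mathcal V)$ is a $C^*$-dynamical system, i.e. each $\mathcal V_x$, $x\in\Gamma^+$, is multiplicative. The same three conditions with $\mathcal V$ and $\mathcal H$ interchanged are likewise equivalent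 to each other. If one of these six conditions holds, then both $\mathcal V$ and $\mathcal H$ are finely representable. -/

import Mathlib

universe u v w

/-- The positive cone `Γ⁺ = {x ∈ Γ : 0 ≤ x}` of a totally ordered abelian group `Γ`. It is an
additive commutative monoid with the operations of `Γ`. -/
abbrev PosCone (Γ : Type u) [AddCommGroup Γ] [LinearOrder Γ] [IsOrderedAddMonoid Γ] : Type u :=
  {x : Γ // 0 ≤ x}

/-- An action of `Γ⁺` on a unital C⋆-algebra `A`: a semigroup homomorphism `x ↦ V x` from `Γ⁺` to
the positive (hence bounded) linear maps on `A` under composition, with `V 0 = id`. -/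
structure PosAction (Γ : Type u) [AddCommGroup Γ] [LinearOrder Γ] [IsOrderedAddMonoid Γ]
    (A : Type v) [CStarAlgebra A] [PartialOrder A] [StarOrderedRing A] where
  /-- the positive linear map attached to an element of the positive cone -/
  toMap : PosCone Γ → (A →ₚ[ℂ] A)
  map_zero : toMap 0 = PositiveLinearMap.id ℂ A
  map_add : ∀ x y : PosCone Γ, toMap (x + y) = (toMap x).comp (toMap y)

section

variable {Γ : Type u} [AddCommGroup Γ] [LinearOrder Γ] [IsOrderedAddMonoid Γ]
  {A : Type v} [CStarAlgebra A] [PartialOrder A] [StarOrderedRing A]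

instance : CoeFun (PosAction Γ A) (fun _ => PosCone Γ → (A →ₚ[ℂ] A)) := ⟨PosAction.toMap⟩

/-- The pair `(V, H)` of actions is an interaction. -/
structure IsInteraction (V H : PosAction Γ A) : Prop where
  vhv : ∀ (x : PosCone Γ) (a : A), V x (H x (V x a)) = V x a
  hvh : ∀ (x : PosCone Γ) (a : A), H x (V x (H x a)) = H x a
  v_mul : ∀ (x : PosCone Γ) (a b : A),
    (a ∈ Set.range (H x) ∨ b ∈ Set.range (H x)) → V x (a * b) = V x a * V x b
  h_mul : ∀ (x : PosCone Γ) (a b : A),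
    (a ∈ Set.range (V x) ∨ b ∈ Set.range (V x)) → H x (a * b) = H x a * H x b

/-- The interaction `(V, H)` is complete. -/
structure IsCompleteInteraction (V H : PosAction Γ A) : Prop extends IsInteraction V H where
  hv : ∀ (x : PosCone Γ) (a : A), H x (V x a) = H x 1 * a * H x 1
  vh : ∀ (x : PosCone Γ) (a : A), V x (H x a) = V x 1 * a * V x 1
  comm : ∀ x y : PosCone Γ, H y 1 * V x 1 = V x 1 * H y 1

/-- Each `V x` is a (not necessarily unital) `*`-endomorphism of `A`. -/
def ActsByEndomorphisms (V : PosAction Γ A) : Prop :=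
  ∀ x : PosCone Γ, ∃ φ : A →⋆ₙₐ[ℂ] A, ∀ a : A, V x a = φ a

/-- `(A, Γ⁺, V)` is a C⋆-dynamical system: the positive linear maps `V x` are multiplicative. -/
def IsCStarDynamicalSystem (V : PosAction Γ A) : Prop :=
  ∀ (x : PosCone Γ) (a b : A), V x (a * b) = V x a * V x b

/-- `V x 1` lies in the center of `A` for all `x`. -/
def HasCentralUnits (V : PosAction Γ A) : Prop :=
  ∀ x : PosCone Γ, V x 1 ∈ Subring.center A

/-- A covariant representation `(C, σ, U)` of the action `V` in the unital C⋆-algebra `C`.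
The field `U_zero` is automatic: the relation `cov` at `x = 0`, `a = 1` gives
`U 0 * star (U 0) = 1`, and `U 0` is idempotent. -/
structure CovariantRepresentation (V : PosAction Γ A) (C : Type w) [CStarAlgebra C] where
  /-- the unital `*`-homomorphism `A → C` -/
  σ : A →⋆ₐ[ℂ] C
  /-- the semigroup of partial isometries in `C` -/
  U : PosCone Γ → C
  σ_injective : Function.Injective σ
  U_zero : U 0 = 1
  U_add : ∀ x y : PosCone Γ, U (x + y) = U x * U y
  U_partialIsometry : ∀ x : PosCone Γ, U x * star (U x) * U x = U x
  cov : ∀ (x : PosCone Γ) (a : A), σ (V x a) = U x * σ a * star (U x)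
  star_mem : ∀ (x : PosCone Γ) (a : A), star (U x) * σ a * U x ∈ Set.range σ

/-- The action `V` is finely representable: it has a covariant representation. (Any covariant
representation restricts to the C⋆-subalgebra generated by the images of `A` and `Γ⁺`, whose
cardinality is bounded in terms of those of `A` and `Γ`; so restricting the universe of `C`
excludes nothing.) -/
def FinelyRepresentable (V : PosAction Γ A) : Prop :=
  ∃ (C : Type (max u v)) (_ : CStarAlgebra C), Nonempty (CovariantRepresentation V C)

end

-- The algebra of complete interactions.

section Interaction

variable {Γ : Type u} [AddCommGroup Γ] [LinearOrder Γ] [IsOrderedAddMonoid Γ]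
  {A : Type v} [CStarAlgebra A] [PartialOrder A] [StarOrderedRing A]

namespace PosAction

-- Equivalences. Put `p = H x 1`, a projection. By completeness `H x ∘ V x` is the compression `a ↦
-- p a p`, and `V x` does not change when its argument is compressed. If `p` is central, the
-- compression is multiplicative; `V x` is multiplicative on the range of `H x`, hence everywhere.
-- If `V x` is multiplicative, so is the compression, and comparing `p a a* p` with `p a p a* p`
-- forces `p` to be central (`hasCentralUnits_iff`).
--
-- Representability. The hypotheses are symmetric, so let `V` be multiplicative. In a covariant
-- representation the symbols `U_{g⁻}^* a U_{g⁺}`, `g ∈ Γ`, satisfy `(U_{g⁻}^* a U_{g⁺})^* (U_{g⁻}^*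
-- b U_{g⁺}) = H_{g⁺}(a* V_{g⁻}(1) b)`. The right side makes sense without a representation and is a
-- positive `A`-valued form; composing it with all positive functionals gives `FellSpace`, on which
-- `A` and `U_y` act by formal left multiplication. The formulas for `U_y` close up because the
-- order is total (`up_eq_zero_or`), and the adjoint of `U_y` is found from the transfer identity
-- `inv_apply_mul`. Degree zero makes the action of `A` faithful (`coeff_faithful`). On the Hilbert
-- space completion `U` represents `V`, and `U^*` represents `H`.

theorem zero_apply (V : PosAction Γ A) (a : A) : V 0 a = a := by rw [V.map_zero]; rfl

theorem add_apply (V : PosAction Γ A) (x y : PosCone Γ) (a : A) : V (x + y) a = V x (V y a) := by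
  rw [V.map_add]; rfl

theorem star_apply_one (V : PosAction Γ A) (x : PosCone Γ) : star (V x 1) = V x 1 := by
  rw [← map_star (V x), star_one]

theorem actsByEndomorphisms_iff (V : PosAction Γ A) :
    ActsByEndomorphisms V ↔ IsCStarDynamicalSystem V := by
  refine ⟨fun h x a b => ?_, fun h x => ⟨?_, ?_⟩⟩
  · obtain ⟨φ, hφ⟩ := h x
    simp only [hφ, map_mul]
  · exact
      { toFun := V x
        map_smul' := fun c a => map_smul (V x) c a
        map_zero' := _root_.map_zero (V x)
        map_add' := _root_.map_add (V x)
        map_mul' := h x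
        map_star' := map_star (V x) }
  · exact fun _ => rfl

end PosAction

namespace IsCompleteInteraction

variable {V H : PosAction Γ A}

theorem symm (h : IsCompleteInteraction V H) : IsCompleteInteraction H V where
  vhv := h.hvh
  hvh := h.vhv
  v_mul := h.h_mul
  h_mul := h.v_mul
  hv := h.vh
  vh := h.hv
  comm x y := (h.comm y x).symm

theorem isIdempotent (h : IsCompleteInteraction V H) (x : PosCone Γ) :
    H x 1 * H x 1 = H x 1 := by
  have hs : star (H x 1) = H x 1 := H.star_apply_one x
  have h1 : H x (V x 1) = H x 1 * H x 1 := by rw [h.hv]; simp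
  -- With `h1` this says `p² = p³` for the self-adjoint `p = H x 1`, so `p² - p` has square zero.
  have h2 : H x (V x 1) = H x (V x 1) * H x 1 := by
    simpa using h.h_mul x (V x 1) 1 (Or.inl ⟨1, rfl⟩)
  rw [h1] at h2
  have h3 : star (H x 1 * H x 1 - H x 1) * (H x 1 * H x 1 - H x 1) = 0 := by
    rw [star_sub, star_mul, hs]
    have h4 : H x 1 * (H x 1 * H x 1 - H x 1) = 0 := by
      rw [mul_sub, ← mul_assoc, ← h2, sub_self]
    rw [sub_mul, mul_assoc, h4, mul_zero, sub_zero]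
  exact sub_eq_zero.mp (CStarRing.star_mul_self_eq_zero_iff _ |>.mp h3)

theorem apply_inv_one (h : IsCompleteInteraction V H) (x : PosCone Γ) : V x (H x 1) = V x 1 := by
  rw [h.vh, mul_one, h.symm.isIdempotent]

theorem apply_compress (h : IsCompleteInteraction V H) (x : PosCone Γ) (a : A) :
    V x (H x 1 * a * H x 1) = V x a := by
  rw [← h.hv, h.vhv]

theorem one_mul_inv_apply (h : IsCompleteInteraction V H) (x : PosCone Γ) (a : A) :
    H x 1 * H x a = H x a := by
  rw [← h.hvh x a, h.hv, ← mul_assoc, ← mul_assoc, h.isIdempotent]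

theorem hasCentralUnits_iff (h : IsCompleteInteraction V H) :
    HasCentralUnits H ↔ IsCStarDynamicalSystem V := by
  refine ⟨fun hc x a b => ?_, fun hm x => ?_⟩
  · have hp := Subring.mem_center_iff.mp (hc x)
    have hi := h.isIdempotent x
    have e : H x 1 * (a * b) * H x 1 = (H x 1 * a * H x 1) * (H x 1 * b * H x 1) := by
      have e' : H x 1 * a * H x 1 * (H x 1 * b * H x 1) =
          H x 1 * (a * (H x 1 * H x 1)) * b * H x 1 := by simp only [mul_assoc]
      rw [e', hi, hp a, ← mul_assoc (H x 1) (H x 1) a, hi]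
      simp only [mul_assoc]
    rw [← h.apply_compress x (a * b), e, h.v_mul x _ _ (Or.inl ⟨V x a, h.hv x a⟩),
      h.apply_compress, h.apply_compress]
  · set p := H x 1 with hp
    have hi : p * p = p := h.isIdempotent x
    have hs : star p = p := H.star_apply_one x
    have key (a b : A) : p * (a * b) * p = (p * a * p) * (p * b * p) := by
      rw [hp, ← h.hv, hm, h.h_mul x _ _ (Or.inl ⟨a, rfl⟩), h.hv, h.hv]
    have left (a : A) : p * a = p * a * p := by
      -- For `d = p a - p a p` one has `d d* = p a a* p - p a p a* p`, which `key` makes zero.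
      rw [← sub_eq_zero, ← CStarRing.mul_star_self_eq_zero_iff]
      have k := key a (star a)
      have k' : p * a * p * (p * star a * p) = p * a * p * star a * p := by
        simp only [← mul_assoc, mul_assoc _ p p, hi]
      rw [k'] at k
      have e1 : star (p * a - p * a * p) = star a * p - p * star a * p := by
        simp [star_sub, star_mul, hs, mul_assoc]
      have e2 : p * a * p * (p * star a * p) = p * a * p * star a * p := k'
      rw [e1, sub_mul, mul_sub, mul_sub, e2]
      simp only [← mul_assoc] at k ⊢
      rw [k]; simp
    refine Subring.mem_center_iff.mpr fun a => ?_
    -- The adjoint of `left` at `star a` is `a p = p a p`.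
    have r := congrArg star (left (star a))
    simp only [star_mul, star_star, hs, ← mul_assoc] at r
    rw [r, ← left a]

theorem tfae (h : IsCompleteInteraction V H) :
    [ActsByEndomorphisms V, HasCentralUnits H, IsCStarDynamicalSystem V].TFAE := by
  tfae_have 1 ↔ 3 := V.actsByEndomorphisms_iff
  tfae_have 2 ↔ 3 := h.hasCentralUnits_iff
  tfae_finish

end IsCompleteInteraction

open scoped ComplexOrder in
/-- Positive linear functionals separate the points of a C⋆-algebra. -/
theorem exists_positive_functional_ne_zero {a : A} (ha : a ≠ 0) :
    ∃ φ : A →ₚ[ℂ] ℂ, φ (star a * a) ≠ 0 := by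
  let K : ProperCone ℝ A :=
    { carrier := {b | 0 ≤ b}
      add_mem' := fun hx hy => add_nonneg hx hy
      zero_mem' := le_refl (0 : A)
      smul_mem' := fun c x hx => smul_nonneg c.2 hx
      isClosed' := CStarAlgebra.isClosed_nonneg }
  have hK (b : A) : b ∈ K ↔ 0 ≤ b := Iff.rfl
  have hx : -(star a * a) ∉ K := by
    rw [hK, neg_nonneg]
    intro hle
    exact ha (CStarRing.star_mul_self_eq_zero_iff _ |>.mp
      (le_antisymm hle (star_mul_self_nonneg a)))
  obtain ⟨f, hf, hf0⟩ := K.hyperplane_separation_point hx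
  -- The separating functional is only real linear; this complex-linear map agrees with it on
  -- self-adjoint elements.
  let g : A →ₗ[ℂ] ℂ :=
    { toFun := fun b => (f (realPart b : A) : ℂ) + Complex.I * (f (imaginaryPart b : A) : ℂ)
      map_add' := fun b c => by simp; ring
      map_smul' := fun z b => by
        apply Complex.ext <;> simp [realPart_smul, imaginaryPart_smul] }
  have hg (b : A) (hb : IsSelfAdjoint b) : g b = (f b : ℂ) := by
    simp [g, hb.coe_realPart, hb.imaginaryPart]
  refine ⟨PositiveLinearMap.mk₀ g fun b hb => ?_, ?_⟩
  · rw [hg b (IsSelfAdjoint.of_nonneg hb)]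
    exact_mod_cast hf b hb
  · change g (star a * a) ≠ 0
    rw [hg _ (IsSelfAdjoint.star_mul_self a)]
    rw [map_neg] at hf0
    exact_mod_cast (neg_lt_zero.mp hf0).ne'

end Interaction

-- Bounded operators on a seminormed space and on its completion.

section Completion

open UniformSpace ContinuousLinearMap

variable {E : Type w} [SeminormedAddCommGroup E] [InnerProductSpace ℂ E]

/-- Null vectors vanish in the completion, so relations that hold up to null vectors become exact.
-/
theorem ContinuousLinearMap.completion_congr {S T : E →L[ℂ] E} (h : ∀ ξ, ‖S ξ - T ξ‖ = 0) :
    S.completion = T.completion := by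
  ext ξ
  induction ξ using Completion.induction_on with
  | hp => apply isClosed_eq <;> fun_prop
  | ih ξ =>
    rw [completion_apply_coe, completion_apply_coe, ← sub_eq_zero, ← Completion.coe_sub,
      ← norm_eq_zero, Completion.norm_coe, h]

theorem ContinuousLinearMap.completion_comp (S T : E →L[ℂ] E) :
    (S ∘L T).completion = S.completion * T.completion := by
  ext ξ
  induction ξ using Completion.induction_on with
  | hp => apply isClosed_eq <;> fun_prop
  | ih ξ => simp

theorem ContinuousLinearMap.completion_add (S T : E →L[ℂ] E) :
    (S + T).completion = S.completion + T.completion := by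
  ext ξ
  induction ξ using Completion.induction_on with
  | hp => apply isClosed_eq <;> fun_prop
  | ih ξ => simp [Completion.coe_add]

theorem ContinuousLinearMap.completion_smul (c : ℂ) (T : E →L[ℂ] E) :
    (c • T).completion = c • T.completion := by
  ext ξ
  induction ξ using Completion.induction_on with
  | hp => exact isClosed_eq (c • T).completion.continuous (c • T.completion).continuous
  | ih ξ => simp

theorem ContinuousLinearMap.completion_id :
    (ContinuousLinearMap.id ℂ E).completion = 1 := by
  ext ξ
  induction ξ using Completion.induction_on with
  | hp => apply isClosed_eq <;> fun_prop
  | ih ξ => simp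

theorem ContinuousLinearMap.star_completion {S T : E →L[ℂ] E}
    (h : ∀ ξ η, inner ℂ (S ξ) η = inner ℂ ξ (T η)) : star S.completion = T.completion := by
  rw [star_eq_adjoint, eq_comm, eq_adjoint_iff]
  intro ξ η
  induction ξ, η using Completion.induction_on₂ with
  | hp => apply isClosed_eq <;> fun_prop
  | ih ξ η =>
    rw [completion_apply_coe, completion_apply_coe, Completion.inner_coe, Completion.inner_coe,
      ← inner_conj_symm, ← h, inner_conj_symm]

theorem ContinuousLinearMap.norm_apply_eq_zero_of_completion_eq_zero {T : E →L[ℂ] E}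
    (h : T.completion = 0) (ξ : E) : ‖T ξ‖ = 0 := by
  rw [← Completion.norm_coe, ← completion_apply_coe, h]
  simp

theorem inner_congr_of_norm_sub_eq_zero {ξ η : E} (h : ‖ξ - η‖ = 0) (ζ : E) :
    inner ℂ ζ ξ = inner ℂ ζ η := by
  rw [← sub_eq_zero, ← inner_sub_right, ← norm_eq_zero]
  refine le_antisymm ((norm_inner_le_norm _ _).trans ?_) (norm_nonneg _)
  rw [h, mul_zero]

end Completion

-- From a representation up to null vectors to a covariant representation.

section PreCovariant

open UniformSpace ContinuousLinearMap

variable {Γ : Type u} [AddCommGroup Γ] [LinearOrder Γ] [IsOrderedAddMonoid Γ]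
  {A : Type v} [CStarAlgebra A] [PartialOrder A] [StarOrderedRing A]

/-- A representation, up to null vectors, of an interaction on a complex vector space with a
positive semidefinite inner product: the coefficients act through `π`, and `u x`, `u' x` are
mutually adjoint implementations of `V x`, `H x`. -/
structure PreCovariantRepresentation (V H : PosAction Γ A)
    (E : Type w) [SeminormedAddCommGroup E] [InnerProductSpace ℂ E] where
  /-- the action of the coefficients -/
  π : A →ₗ[ℂ] E →ₗ[ℂ] E
  /-- the action of the positive cone -/
  u : PosCone Γ → E →ₗ[ℂ] E
  /-- the formal adjoints of the operators `u x` -/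
  u' : PosCone Γ → E →ₗ[ℂ] E
  π_mul : ∀ a b ξ, π (a * b) ξ = π a (π b ξ)
  π_one : ∀ ξ, ‖π 1 ξ - ξ‖ = 0
  π_adj : ∀ a ξ η, inner ℂ (π a ξ) η = inner ℂ ξ (π (star a) η)
  π_faithful : ∀ a, (∀ ξ, ‖π a ξ‖ = 0) → a = 0
  u_adj : ∀ x ξ η, inner ℂ (u x ξ) η = inner ℂ ξ (u' x η)
  u_add : ∀ x y ξ, u (x + y) ξ = u x (u y ξ)
  u_π : ∀ x a ξ, u x (π a ξ) = π (V x a) (u x ξ)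
  u_u' : ∀ x ξ, ‖u x (u' x ξ) - π (V x 1) ξ‖ = 0
  u'_u : ∀ x ξ, ‖u' x (u x ξ) - π (H x 1) ξ‖ = 0

namespace PreCovariantRepresentation

variable {V H : PosAction Γ A} {E : Type w} [SeminormedAddCommGroup E] [InnerProductSpace ℂ E]
  (R : PreCovariantRepresentation V H E)
include R

theorem norm_π_le (a : A) (ξ : E) : ‖R.π a ξ‖ ≤ ‖a‖ * ‖ξ‖ := by
  -- Then `‖a‖² ‖ξ‖² - ‖π a ξ‖² = ‖π c ξ‖² ≥ 0`.
  obtain ⟨c, hc⟩ : ∃ c : A, ((‖a‖ ^ 2 : ℝ) : ℂ) • (1 : A) - star a * a = star c * c := by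
    refine CStarAlgebra.nonneg_iff_eq_star_mul_self.mp (sub_nonneg.mpr ?_)
    have := CStarAlgebra.star_mul_le_algebraMap_norm_sq (a := a)
    rwa [Algebra.algebraMap_eq_smul_one, ← Complex.coe_smul] at this
  have key : inner ℂ (R.π c ξ) (R.π c ξ) =
      ((‖a‖ ^ 2 : ℝ) : ℂ) * inner ℂ ξ (R.π 1 ξ) - inner ℂ (R.π a ξ) (R.π a ξ) := by
    rw [R.π_adj, R.π_adj a, ← R.π_mul, ← R.π_mul, ← hc, map_sub, map_smul, LinearMap.sub_apply,
      LinearMap.smul_apply, inner_sub_right, inner_smul_right]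
  rw [inner_congr_of_norm_sub_eq_zero (R.π_one ξ), inner_self_eq_norm_sq_to_K, inner_self_eq_norm_sq_to_K, inner_self_eq_norm_sq_to_K] at key
  have key' : ‖R.π c ξ‖ ^ 2 = ‖a‖ ^ 2 * ‖ξ‖ ^ 2 - ‖R.π a ξ‖ ^ 2 := by
    simp only [Complex.coe_algebraMap] at key
    exact_mod_cast key
  refine abs_le_of_sq_le_sq' ?_ (by positivity) |>.2
  nlinarith [sq_nonneg ‖R.π c ξ‖]

theorem norm_u_le (x : PosCone Γ) (ξ : E) : ‖R.u x ξ‖ ≤ √‖H x 1‖ * ‖ξ‖ := by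
  refine abs_le_of_sq_le_sq' ?_ (by positivity) |>.2
  rw [mul_pow, Real.sq_sqrt (norm_nonneg _), ← inner_self_eq_norm_sq (𝕜 := ℂ), R.u_adj,
    inner_congr_of_norm_sub_eq_zero (R.u'_u x ξ)]
  refine (RCLike.re_le_norm _).trans ((norm_inner_le_norm _ _).trans ?_)
  nlinarith [R.norm_π_le (H x 1) ξ, norm_nonneg ξ]

theorem u'_adj (x : PosCone Γ) (ξ η : E) : inner ℂ (R.u' x ξ) η = inner ℂ ξ (R.u x η) := by
  rw [← inner_conj_symm, ← R.u_adj, inner_conj_symm]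

theorem norm_u'_le (x : PosCone Γ) (ξ : E) : ‖R.u' x ξ‖ ≤ √‖V x 1‖ * ‖ξ‖ := by
  refine abs_le_of_sq_le_sq' ?_ (by positivity) |>.2
  rw [mul_pow, Real.sq_sqrt (norm_nonneg _), ← inner_self_eq_norm_sq (𝕜 := ℂ), R.u'_adj,
    inner_congr_of_norm_sub_eq_zero (R.u_u' x ξ)]
  refine (RCLike.re_le_norm _).trans ((norm_inner_le_norm _ _).trans ?_)
  nlinarith [R.norm_π_le (V x 1) ξ, norm_nonneg ξ]

/-- The operator `π a` as a bounded operator on the pre-Hilbert space. -/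
noncomputable def πL (a : A) : E →L[ℂ] E := (R.π a).mkContinuous ‖a‖ (R.norm_π_le a)

/-- The operator `u x` as a bounded operator on the pre-Hilbert space. -/
noncomputable def uL (x : PosCone Γ) : E →L[ℂ] E :=
  (R.u x).mkContinuous (√‖H x 1‖) (R.norm_u_le x)

/-- The operator `u' x` as a bounded operator on the pre-Hilbert space. -/
noncomputable def uL' (x : PosCone Γ) : E →L[ℂ] E :=
  (R.u' x).mkContinuous (√‖V x 1‖) (R.norm_u'_le x)

/-- The representation of the coefficient algebra on the Hilbert space completion. -/
noncomputable def σ : A →⋆ₐ[ℂ] (Completion E →L[ℂ] Completion E) :=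
  { AlgHom.ofLinearMap
      { toFun := fun a => (R.πL a).completion
        map_add' := fun a b => by
          rw [← completion_add]
          exact completion_congr fun ξ => by simp [πL]
        map_smul' := fun c a => by
          rw [RingHom.id_apply, ← completion_smul]
          exact completion_congr fun ξ => by simp [πL] }
      (by
        rw [← completion_id]
        exact completion_congr fun ξ => R.π_one ξ)
      (fun a b => by
        change (R.πL (a * b)).completion = (R.πL a).completion * (R.πL b).completion
        rw [← completion_comp]
        exact completion_congr fun ξ => by simp [πL, R.π_mul]) with
    map_star' := fun a => (star_completion (S := R.πL a) (T := R.πL (star a)) (R.π_adj a)).symm }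

theorem σ_apply (a : A) : R.σ a = (R.πL a).completion := rfl

theorem σ_injective : Function.Injective R.σ := by
  rw [injective_iff_map_eq_zero]
  intro a ha
  exact R.π_faithful a fun ξ => norm_apply_eq_zero_of_completion_eq_zero (T := R.πL a) ha ξ

/-- The operators implementing `V` on the Hilbert space completion. -/
noncomputable def U (x : PosCone Γ) : Completion E →L[ℂ] Completion E := (R.uL x).completion

theorem U_add (x y : PosCone Γ) : R.U (x + y) = R.U x * R.U y := by
  rw [U, U, U, ← completion_comp]
  exact completion_congr fun ξ => by simp [uL, R.u_add]

theorem star_U (x : PosCone Γ) : star (R.U x) = (R.uL' x).completion :=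
  star_completion (R.u_adj x)

theorem U_σ (x : PosCone Γ) (a : A) : R.U x * R.σ a = R.σ (V x a) * R.U x := by
  rw [U, σ_apply, σ_apply, ← completion_comp, ← completion_comp]
  exact completion_congr fun ξ => by simp [uL, πL, R.u_π]

theorem U_star_U (x : PosCone Γ) : R.U x * star (R.U x) = R.σ (V x 1) := by
  rw [star_U, U, σ_apply, ← completion_comp]
  exact completion_congr fun ξ => R.u_u' x ξ

theorem star_U_U (x : PosCone Γ) : star (R.U x) * R.U x = R.σ (H x 1) := by
  rw [star_U, U, σ_apply, ← completion_comp]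
  exact completion_congr fun ξ => R.u'_u x ξ

theorem U_partialIsometry (x : PosCone Γ) : R.U x * star (R.U x) * R.U x = R.U x := by
  rw [R.U_star_U, ← R.U_σ, map_one, mul_one]

theorem U_zero : R.U 0 = 1 := by
  have h1 : R.U 0 * star (R.U 0) = 1 := by rw [R.U_star_U, V.zero_apply, map_one]
  have h2 : R.U 0 * R.U 0 = R.U 0 := by rw [← R.U_add, add_zero]
  calc R.U 0 = R.U 0 * (R.U 0 * star (R.U 0)) := by rw [h1, mul_one]
    _ = 1 := by rw [← mul_assoc, h2, h1]

theorem cov (hV : IsCStarDynamicalSystem V)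
    (x : PosCone Γ) (a : A) : R.σ (V x a) = R.U x * R.σ a * star (R.U x) := by
  rw [R.U_σ, mul_assoc, R.U_star_U, ← map_mul, ← hV, mul_one]

/-- Since `U^* U = σ(H_x(1))` fixes `σ(H_x(a))` from the left, moving `σ(H_x(a))` past `U` turns it
into `V_x(H_x(a)) = V_x(1) a V_x(1)`, whose outer factors `U` and `U^*` absorb. -/
theorem cov' (h : IsCompleteInteraction V H)
    (x : PosCone Γ) (a : A) : R.σ (H x a) = star (R.U x) * R.σ a * R.U x := by
  have hU : R.σ (V x 1) * R.U x = R.U x := by rw [← R.U_σ, map_one, mul_one]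
  have hU' : star (R.U x) * R.σ (V x 1) = star (R.U x) := by
    have := congrArg star hU
    rwa [star_mul, ← map_star, V.star_apply_one] at this
  calc R.σ (H x a) = star (R.U x) * R.U x * R.σ (H x a) := by
        rw [R.star_U_U, ← map_mul, h.one_mul_inv_apply]
    _ = star (R.U x) * R.σ (V x 1 * a * V x 1) * R.U x := by
        rw [mul_assoc, R.U_σ, h.vh, ← mul_assoc]
    _ = star (R.U x) * R.σ (V x 1) * R.σ a * (R.σ (V x 1) * R.U x) := by
        simp only [map_mul, mul_assoc]
    _ = _ := by rw [hU, hU']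

/-- The covariant representation of `V` on the Hilbert space completion. -/
noncomputable def toCovariant (h : IsCompleteInteraction V H) (hV : IsCStarDynamicalSystem V) :
    CovariantRepresentation V (Completion E →L[ℂ] Completion E) where
  σ := R.σ
  U := R.U
  σ_injective := R.σ_injective
  U_zero := R.U_zero
  U_add := R.U_add
  U_partialIsometry := R.U_partialIsometry
  cov := R.cov hV
  star_mem x a := ⟨H x a, R.cov' h x a⟩

/-- The covariant representation of `H` on the Hilbert space completion. -/
noncomputable def toCovariant' (h : IsCompleteInteraction V H) (hV : IsCStarDynamicalSystem V) :
    CovariantRepresentation H (Completion E →L[ℂ] Completion E) where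
  σ := R.σ
  U x := star (R.U x)
  σ_injective := R.σ_injective
  U_zero := by rw [R.U_zero, star_one]
  U_add x y := by rw [add_comm, R.U_add, star_mul]
  U_partialIsometry x := by
    have := congrArg star (R.U_partialIsometry x)
    simpa [star_mul, mul_assoc] using this
  cov x a := by rw [star_star, R.cov' h]
  star_mem x a := ⟨V x a, by rw [star_star, R.cov hV]⟩

end PreCovariantRepresentation

end PreCovariant

-- Positive and negative parts under translation.

section PosCone

variable {Γ : Type u} [AddCommGroup Γ] [LinearOrder Γ] [IsOrderedAddMonoid Γ]

namespace PosCone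

/-- The positive part of `g`, as an element of the positive cone. -/
def pos (g : Γ) : PosCone Γ := ⟨max g 0, le_max_right _ _⟩

/-- The negative part of `g`, as an element of the positive cone. -/
def neg (g : Γ) : PosCone Γ := ⟨max (-g) 0, le_max_right _ _⟩

/-- The increase of the positive part under translation by `y`. -/
def up (y : PosCone Γ) (g : Γ) : PosCone Γ :=
  ⟨max (y.1 + g) 0 - max g 0, sub_nonneg.mpr (max_le_max (le_add_of_nonneg_left y.2) le_rfl)⟩

/-- The decrease of the negative part under translation by `y`. -/
def down (y : PosCone Γ) (g : Γ) : PosCone Γ :=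
  ⟨max (-g) 0 - max (-(y.1 + g)) 0,
    sub_nonneg.mpr (max_le_max (neg_le_neg (le_add_of_nonneg_left y.2)) le_rfl)⟩

theorem pos_add (y : PosCone Γ) (g : Γ) : pos (y.1 + g) = pos g + up y g :=
  Subtype.ext (add_sub_cancel _ _).symm

theorem neg_eq (y : PosCone Γ) (g : Γ) : neg g = neg (y.1 + g) + down y g :=
  Subtype.ext (add_sub_cancel _ _).symm

theorem up_add (x y : PosCone Γ) (g : Γ) : up (x + y) g = up x (y.1 + g) + up y g := by
  refine Subtype.ext ?_
  change max (x.1 + y.1 + g) 0 - max g 0 =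
    max (x.1 + (y.1 + g)) 0 - max (y.1 + g) 0 + (max (y.1 + g) 0 - max g 0)
  rw [add_assoc]; abel

theorem max_sub_max_neg (g : Γ) : max g 0 - max (-g) 0 = g := by
  rcases le_total 0 g with h | h
  · rw [max_eq_left h, max_eq_right (neg_nonpos.mpr h), sub_zero]
  · rw [max_eq_right h, max_eq_left (neg_nonneg.mpr h), zero_sub, neg_neg]

theorem eq_up_add_down (y : PosCone Γ) (g : Γ) : y = up y g + down y g := by
  refine Subtype.ext ?_
  change y.1 = max (y.1 + g) 0 - max g 0 + (max (-g) 0 - max (-(y.1 + g)) 0)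
  have h1 := max_sub_max_neg g
  have h2 := max_sub_max_neg (y.1 + g)
  calc y.1 = (y.1 + g) - g := (add_sub_cancel_right _ _).symm
    _ = (max (y.1 + g) 0 - max (-(y.1 + g)) 0) - (max g 0 - max (-g) 0) := by rw [h1, h2]
    _ = _ := by abel

/-- Totality of the order enters here: either `y + g ≤ 0`, and only the negative part has moved, or
`y + g ≥ 0`, and no negative part remains. -/
theorem up_eq_zero_or (y : PosCone Γ) (g : Γ) : up y g = 0 ∨ neg (y.1 + g) = 0 := by
  rcases le_total 0 (y.1 + g) with h | h
  · exact Or.inr (Subtype.ext (max_eq_right (neg_nonpos.mpr h)))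
  · refine Or.inl (Subtype.ext ?_)
    change max (y.1 + g) 0 - max g 0 = 0
    rw [max_eq_right h, max_eq_right ((le_add_of_nonneg_left y.2).trans h), sub_zero]

theorem neg_add_eq (y : PosCone Γ) (g : Γ) : neg (y.1 + g) + y = up y g + neg g := by
  calc neg (y.1 + g) + y = neg (y.1 + g) + (up y g + down y g) :=
        congrArg _ (eq_up_add_down y g)
    _ = up y g + neg g := by rw [add_left_comm, ← neg_eq]

theorem pos_zero : pos (0 : Γ) = 0 := Subtype.ext (max_self 0)

theorem neg_zero : neg (0 : Γ) = 0 := Subtype.ext (by simp [neg])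

end PosCone

end PosCone

-- The regular representation on symbols `U_{g⁻}^* a U_{g⁺}`.

section Fell

open PosCone
open scoped ComplexOrder

variable {Γ : Type u} [AddCommGroup Γ] [LinearOrder Γ] [IsOrderedAddMonoid Γ]
  {A : Type v} [CStarAlgebra A] [PartialOrder A] [StarOrderedRing A]

/-- The algebraic direct sum over `φ` and `g` of copies of `A`. The summand at `(φ, g)` models the
symbols `U_{g⁻}^* a U_{g⁺}` of degree `g`, weighted by the positive functional `φ`. -/
@[nolint unusedArguments]
def FellSpace (_V _H : PosAction Γ A) : Type (max u v) := ((A →ₚ[ℂ] ℂ) × Γ) →₀ A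

noncomputable instance (V H : PosAction Γ A) : AddCommGroup (FellSpace V H) :=
  inferInstanceAs (AddCommGroup (((A →ₚ[ℂ] ℂ) × Γ) →₀ A))

noncomputable instance (V H : PosAction Γ A) : Module ℂ (FellSpace V H) :=
  inferInstanceAs (Module ℂ (((A →ₚ[ℂ] ℂ) × Γ) →₀ A))

namespace FellSpace

variable (V H : PosAction Γ A)

/-- The sesquilinear form on the summand at `(φ, g)`. -/
noncomputable def form (i : (A →ₚ[ℂ] ℂ) × Γ) (a b : A) : ℂ :=
  i.1 (H (pos i.2) (star a * V (neg i.2) 1 * b))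

theorem conj_form (i : (A →ₚ[ℂ] ℂ) × Γ) (a b : A) :
    (starRingEnd ℂ) (form V H i b a) = form V H i a b := by
  rw [form, form, ← Complex.star_def, ← map_star i.1, ← map_star (H _)]
  simp [star_mul, V.star_apply_one, mul_assoc]

theorem form_self_nonneg (i : (A →ₚ[ℂ] ℂ) × Γ) (a : A) : 0 ≤ form V H i a a :=
  map_nonneg i.1 (map_nonneg (H _) (star_left_conjugate_nonneg
    (map_nonneg (V _) zero_le_one) a))

theorem form_add_left (i : (A →ₚ[ℂ] ℂ) × Γ) (a b c : A) :
    form V H i (a + b) c = form V H i a c + form V H i b c := by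
  simp [form, add_mul]

theorem form_smul_left (i : (A →ₚ[ℂ] ℂ) × Γ) (z : ℂ) (a c : A) :
    form V H i (z • a) c = (starRingEnd ℂ) z * form V H i a c := by
  simp [form]

theorem form_zero_left (i : (A →ₚ[ℂ] ℂ) × Γ) (c : A) : form V H i 0 c = 0 := by
  simp [form]

theorem form_zero_right (i : (A →ₚ[ℂ] ℂ) × Γ) (c : A) : form V H i c 0 = 0 := by
  simp [form]

variable {V H}

/-- The inner product of the algebraic direct sum. -/
noncomputable def innerForm (ξ η : FellSpace V H) : ℂ :=
  Finsupp.sum (α := (A →ₚ[ℂ] ℂ) × Γ) (M := A) ξ fun i a =>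
    form V H i a ((show ((A →ₚ[ℂ] ℂ) × Γ) →₀ A from η) i)

theorem innerForm_eq_sum (ξ η : ((A →ₚ[ℂ] ℂ) × Γ) →₀ A) {s : Finset ((A →ₚ[ℂ] ℂ) × Γ)}
    (hs : ξ.support ⊆ s) :
    innerForm (V := V) (H := H) ξ η = ∑ i ∈ s, form V H i (ξ i) (η i) :=
  Finsupp.sum_of_support_subset _ hs _ fun i _ => form_zero_left V H i _

/-- The positive semidefinite inner product on the algebraic direct sum. -/
noncomputable abbrev core : PreInnerProductSpace.Core ℂ (FellSpace V H) where
  inner := innerForm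
  conj_inner_symm ξ η := by
    classical
    rw [innerForm_eq_sum η ξ (Finset.subset_union_left (s₂ := Finsupp.support ξ)),
      innerForm_eq_sum ξ η (Finset.subset_union_right (s₁ := Finsupp.support η)), map_sum]
    exact Finset.sum_congr rfl fun i _ => conj_form V H i _ _
  re_inner_nonneg ξ := by
    refine (RCLike.nonneg_iff.mp (?_ : 0 ≤ innerForm ξ ξ)).1
    exact Finset.sum_nonneg fun i _ => form_self_nonneg V H i _
  add_left ξ η ζ :=
    Finsupp.sum_add_index' (fun i => form_zero_left V H i _) fun i _ _ => form_add_left V H i _ _ _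
  smul_left ξ η z := by
    rw [innerForm_eq_sum (z • ξ : FellSpace V H) η
      (Finsupp.support_smul (b := z) (g := (ξ : ((A →ₚ[ℂ] ℂ) × Γ) →₀ A))),
      innerForm_eq_sum ξ η subset_rfl, Finset.mul_sum]
    exact Finset.sum_congr rfl fun i _ => form_smul_left V H i z _ _

noncomputable instance : SeminormedAddCommGroup (FellSpace V H) :=
  InnerProductSpace.Core.toSeminormedAddCommGroup (c := core)

noncomputable instance : InnerProductSpace ℂ (FellSpace V H) := InnerProductSpace.ofCore core

/-- The inclusion of the summand at `i`. -/
noncomputable def single (i : (A →ₚ[ℂ] ℂ) × Γ) : A →ₗ[ℂ] FellSpace V H := Finsupp.lsingle i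

/-- The linear map that is `t i` from the summand at `i` to the summand at `τ i`. -/
noncomputable def lift (τ : (A →ₚ[ℂ] ℂ) × Γ → (A →ₚ[ℂ] ℂ) × Γ)
    (t : (A →ₚ[ℂ] ℂ) × Γ → A →ₗ[ℂ] A) : FellSpace V H →ₗ[ℂ] FellSpace V H :=
  Finsupp.lsum ℂ fun i => single (τ i) ∘ₗ t i

theorem lift_single (τ : (A →ₚ[ℂ] ℂ) × Γ → (A →ₚ[ℂ] ℂ) × Γ)
    (t : (A →ₚ[ℂ] ℂ) × Γ → A →ₗ[ℂ] A) (i : (A →ₚ[ℂ] ℂ) × Γ) (a : A) :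
    lift τ t (single (V := V) (H := H) i a) = single (τ i) (t i a) := by
  refine (Finsupp.lsum_single ℂ _ _ _).trans rfl

theorem induction {p : FellSpace V H → Prop} (h0 : p 0) (hadd : ∀ ξ η, p ξ → p η → p (ξ + η))
    (hs : ∀ i a, p (single i a)) (ξ : FellSpace V H) : p ξ :=
  Finsupp.induction_linear ξ h0 hadd hs

theorem ext_single {S T : FellSpace V H →ₗ[ℂ] FellSpace V H}
    (h : ∀ i a, S (single i a) = T (single i a)) : S = T :=
  Finsupp.lhom_ext h

open Classical in
theorem inner_single (i j : (A →ₚ[ℂ] ℂ) × Γ) (a b : A) :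
    inner ℂ (single (V := V) (H := H) i a) (single j b) =
      if i = j then form V H i a b else 0 := by
  change innerForm (Finsupp.single i a) (Finsupp.single j b) = _
  refine (Finsupp.sum_single_index
    (h := fun k c => form V H k c ((Finsupp.single j b : ((A →ₚ[ℂ] ℂ) × Γ) →₀ A) k))
    (form_zero_left V H i _)).trans ?_
  split_ifs with h
  · subst h
    exact congrArg _ Finsupp.single_eq_same
  · refine (congrArg (form V H i a) (Finsupp.single_eq_of_ne h)).trans (form_zero_right V H i a)

theorem norm_single_eq_zero {i : (A →ₚ[ℂ] ℂ) × Γ} {a : A} (h : form V H i a a = 0) :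
    ‖single (V := V) (H := H) i a‖ = 0 := by
  rw [← sq_eq_zero_iff, ← inner_self_eq_norm_sq (𝕜 := ℂ), inner_single, if_pos rfl, h, map_zero]

theorem norm_sub_eq_zero {S T : FellSpace V H →ₗ[ℂ] FellSpace V H}
    (h : ∀ i a, ‖S (single i a) - T (single i a)‖ = 0) (ξ : FellSpace V H) :
    ‖S ξ - T ξ‖ = 0 := by
  induction ξ using induction with
  | h0 => simp
  | hadd ξ η hξ hη =>
    rw [map_add, map_add, add_sub_add_comm]
    exact le_antisymm ((norm_add_le _ _).trans (by rw [hξ, hη, add_zero])) (norm_nonneg _)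
  | hs i a => exact h i a

theorem adjoint_of_single {S T : FellSpace V H →ₗ[ℂ] FellSpace V H}
    (h : ∀ i j a b, inner ℂ (S (single i a)) (single j b) = inner ℂ (single i a) (T (single j b)))
    (ξ η : FellSpace V H) : inner ℂ (S ξ) η = inner ℂ ξ (T η) := by
  induction ξ using induction with
  | h0 => simp
  | hadd ξ ξ' hξ hξ' => rw [map_add, inner_add_left, inner_add_left, hξ, hξ']
  | hs i a =>
    induction η using induction with
    | h0 => simp
    | hadd η η' hη hη' => rw [map_add, inner_add_right, inner_add_right, hη, hη']
    | hs j b => exact h i j a b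

/-- `H_{g⁺}` sees its argument only through compression by `V_{g⁺}(1)`. This is the test by which
the relations below hold up to null vectors. -/
theorem form_self_eq_zero (h : IsCompleteInteraction V H) {i : (A →ₚ[ℂ] ℂ) × Γ} {a : A}
    (ha : V (neg i.2) 1 * a * V (pos i.2) 1 = 0) : form V H i a a = 0 := by
  have hs := V.star_apply_one (neg i.2)
  have e : V (pos i.2) 1 * (star a * V (neg i.2) 1 * a) * V (pos i.2) 1 =
      star (V (neg i.2) 1 * a * V (pos i.2) 1) * (V (neg i.2) 1 * a * V (pos i.2) 1) := by
    rw [star_mul, star_mul, hs, V.star_apply_one]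
    conv_lhs => rw [← h.symm.isIdempotent (neg i.2)]
    simp only [mul_assoc]
  rw [form, ← h.symm.apply_compress, e, ha, mul_zero, _root_.map_zero, _root_.map_zero]

/-- `H x` is a transfer operator for the endomorphism `V x`; centrality of `H x 1` lets `a` come
out. -/
theorem inv_apply_mul (h : IsCompleteInteraction V H) (hV : IsCStarDynamicalSystem V)
    (x : PosCone Γ) (a b : A) : H x (V x a * b) = a * H x b := by
  have hc := Subring.mem_center_iff.mp (h.hasCentralUnits_iff.mpr hV x)
  rw [h.h_mul x _ _ (Or.inl ⟨a, rfl⟩), h.hv, mul_assoc, h.one_mul_inv_apply, ← hc, mul_assoc,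
    h.one_mul_inv_apply]

theorem apply_one_mul_apply (hV : IsCStarDynamicalSystem V) (x : PosCone Γ) (a : A) :
    V x 1 * V x a = V x a := by rw [← hV, one_mul]

theorem apply_mul_apply_one (hV : IsCStarDynamicalSystem V) (x : PosCone Γ) (a : A) :
    V x a * V x 1 = V x a := by rw [← hV, mul_one]

theorem apply_one_mul_apply_add (hV : IsCStarDynamicalSystem V) (x y : PosCone Γ) (a : A) :
    V x 1 * V (x + y) a = V (x + y) a := by rw [V.add_apply, apply_one_mul_apply hV]

theorem apply_add_mul_apply_one (hV : IsCStarDynamicalSystem V) (x y : PosCone Γ) (a : A) :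
    V (x + y) a * V x 1 = V (x + y) a := by rw [V.add_apply, apply_mul_apply_one hV]

/-- The projection attached to `neg (y + g)` acts as the identity on the range of
`a ↦ V (up y g) (V (neg g) 1 * a)`. -/
theorem neg_mul_up (hV : IsCStarDynamicalSystem V) (y : PosCone Γ) (g : Γ) :
    V (neg (y.1 + g)) 1 * V (up y g) (V (neg g) 1) = V (up y g) (V (neg g) 1) := by
  rcases up_eq_zero_or y g with h | h
  · rw [h, V.zero_apply, neg_eq y g, apply_one_mul_apply_add hV]
  · rw [h, V.zero_apply, one_mul]

theorem up_mul_neg (hV : IsCStarDynamicalSystem V) (y : PosCone Γ) (g : Γ) :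
    V (up y g) (V (neg g) 1) * V (neg (y.1 + g)) 1 = V (up y g) (V (neg g) 1) := by
  rcases up_eq_zero_or y g with h | h
  · rw [h, V.zero_apply, neg_eq y g, apply_add_mul_apply_one hV]
  · rw [h, V.zero_apply, mul_one]

/-- If `up y g = 0`, then `neg g = neg (y + g) + y` and both sides are `V_{g⁻}(1)`. Otherwise `y =
neg g + up y g`, and `V_{g⁻} H_{g⁻}` is compression by `V_{g⁻}(1)`. -/
theorem neg_compress (h : IsCompleteInteraction V H)
    (y : PosCone Γ) (g : Γ) :
    V (neg g) 1 * H (up y g) 1 * V (neg g) 1 = V (neg g) (H y 1) := by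
  rcases up_eq_zero_or y g with hu | hn
  · have hy : y = down y g := by conv_lhs => rw [eq_up_add_down y g, hu, zero_add]
    rw [hu, H.zero_apply, mul_one, h.symm.isIdempotent]
    conv_rhs => rw [hy, neg_eq y g, V.add_apply, h.apply_inv_one]
    rw [← V.add_apply, ← neg_eq]
  · have hy : y = neg g + up y g := by
      conv_lhs => rw [eq_up_add_down y g, add_comm]
      rw [neg_eq y g, hn, zero_add]
    conv_rhs => rw [hy, H.add_apply, h.vh]

-- The operators on the space of symbols and their relations.

variable (V H) in
/-- The action of the coefficient algebra on `FellSpace V H`. -/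
noncomputable def coeff (c : A) : FellSpace V H →ₗ[ℂ] FellSpace V H :=
  lift id fun i => LinearMap.mulLeft ℂ (V (neg i.2) c)

theorem coeff_single (c : A) (i : (A →ₚ[ℂ] ℂ) × Γ) (a : A) :
    coeff V H c (single i a) = single i (V (neg i.2) c * a) := lift_single _ _ _ _

variable (V H) in
/-- The translation by `y` implementing `V y` on `FellSpace V H`. -/
noncomputable def shift (y : PosCone Γ) : FellSpace V H →ₗ[ℂ] FellSpace V H :=
  -- With `k = y + g` and `u = up y g`, covariance gives `U_y U_{g⁻}^* = U_{k⁻}^* U_u V_{g⁻}(1)`;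
  -- moving `U_u` past the coefficient yields this formula.
  lift (fun i => (i.1, y.1 + i.2)) fun i =>
    (V (up y i.2)).toLinearMap ∘ₗ LinearMap.mulLeft ℂ (V (neg i.2) 1)

theorem shift_single (y : PosCone Γ) (φ : A →ₚ[ℂ] ℂ) (g : Γ) (a : A) :
    shift V H y (single (φ, g) a) = single (φ, y.1 + g) (V (up y g) (V (neg g) 1 * a)) :=
  lift_single _ _ _ _

variable (V H) in
/-- The translation by `-y` implementing `H y` on `FellSpace V H`. -/
noncomputable def shiftInv (y : PosCone Γ) : FellSpace V H →ₗ[ℂ] FellSpace V H :=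
  lift (fun i => (i.1, i.2 - y.1)) fun i => (H (up y (i.2 - y.1))).toLinearMap

theorem shiftInv_single (y : PosCone Γ) (φ : A →ₚ[ℂ] ℂ) (g : Γ) (a : A) :
    shiftInv V H y (single (φ, g) a) = single (φ, g - y.1) (H (up y (g - y.1)) a) :=
  lift_single _ _ _ _

theorem shiftInv_single_add (y : PosCone Γ) (φ : A →ₚ[ℂ] ℂ) (g : Γ) (a : A) :
    shiftInv V H y (single (φ, y.1 + g) a) = single (φ, g) (H (up y g) a) := by
  rw [shiftInv_single, add_sub_cancel_left]

theorem coeff_faithful {a : A} (ha : ∀ ξ, ‖coeff V H a ξ‖ = 0) : a = 0 := by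
  by_contra hne
  obtain ⟨φ, hφ⟩ := exists_positive_functional_ne_zero hne
  -- In degree zero this inner product is `φ(a* a)`.
  have h1 : inner ℂ (coeff V H a (single (φ, 0) 1)) (coeff V H a (single (φ, 0) 1)) = (0 : ℂ) := by
    rw [inner_self_eq_norm_sq_to_K, ha]
    simp
  rw [coeff_single, inner_single, if_pos rfl, form] at h1
  simp only [PosCone.neg_zero, pos_zero, V.zero_apply, H.zero_apply, mul_one] at h1
  exact hφ h1

theorem coeff_adjoint (hV : IsCStarDynamicalSystem V) (c : A) (ξ η : FellSpace V H) :
    inner ℂ (coeff V H c ξ) η = inner ℂ ξ (coeff V H (star c) η) := by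
  refine adjoint_of_single (fun i j a b => ?_) ξ η
  rw [coeff_single, coeff_single, inner_single, inner_single]
  split_ifs with hij
  · subst hij
    rw [form, form, star_mul, ← map_star (V _), mul_assoc (star a), apply_mul_apply_one hV,
      ← mul_assoc, mul_assoc (star a) (V _ 1), apply_one_mul_apply hV]
  · rfl

/-- The projection of degree `y + g` is absorbed on the left, `H_{(y+g)⁺}` factors as `H_{g⁺} H_{up
y g}`, and the transfer identity removes `V_{up y g}`. -/
theorem form_shift (h : IsCompleteInteraction V H) (hV : IsCStarDynamicalSystem V)
    (y : PosCone Γ) (φ : A →ₚ[ℂ] ℂ) (g : Γ) (a b : A) :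
    form V H (φ, y.1 + g) (V (up y g) (V (neg g) 1 * a)) b =
      form V H (φ, g) a (H (up y g) b) := by
  simp only [form]
  rw [hV, star_mul, ← map_star (V _), ← map_star (V _), V.star_apply_one, mul_assoc (V _ (star a)),
    up_mul_neg hV, ← hV, pos_add, H.add_apply, inv_apply_mul h hV]

theorem shift_adjoint (h : IsCompleteInteraction V H) (hV : IsCStarDynamicalSystem V)
    (y : PosCone Γ) (ξ η : FellSpace V H) :
    inner ℂ (shift V H y ξ) η = inner ℂ ξ (shiftInv V H y η) := by
  refine adjoint_of_single ?_ ξ η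
  rintro ⟨φ, g⟩ ⟨ψ, k⟩ a b
  obtain ⟨k, rfl⟩ : ∃ k', k = y.1 + k' := ⟨k - y.1, (add_sub_cancel _ _).symm⟩
  rw [shift_single, shiftInv_single_add, inner_single, inner_single]
  by_cases hij : (φ, g) = (ψ, k)
  · obtain ⟨rfl, rfl⟩ := Prod.mk.inj hij
    rw [if_pos rfl, if_pos rfl]
    exact form_shift h hV y φ g a b
  · rw [if_neg hij, if_neg]
    intro he
    exact hij (Prod.ext (Prod.mk.inj he).1 (add_left_cancel (Prod.mk.inj he).2))

theorem shift_add (hV : IsCStarDynamicalSystem V) (x y : PosCone Γ) (ξ : FellSpace V H) :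
    shift V H (x + y) ξ = shift V H x (shift V H y ξ) := by
  refine LinearMap.congr_fun (g := shift V H x ∘ₗ shift V H y) (ext_single ?_) ξ
  rintro ⟨φ, g⟩ a
  have hg : (x + y).1 + g = x.1 + (y.1 + g) := add_assoc _ _ _
  rw [LinearMap.comp_apply, shift_single, shift_single, shift_single, hg, up_add, V.add_apply,
    hV (up y g), ← mul_assoc, neg_mul_up hV]

theorem shift_coeff (hV : IsCStarDynamicalSystem V) (y : PosCone Γ) (c : A) (ξ : FellSpace V H) :
    shift V H y (coeff V H c ξ) = coeff V H (V y c) (shift V H y ξ) := by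
  refine LinearMap.congr_fun (f := shift V H y ∘ₗ coeff V H c)
    (g := coeff V H (V y c) ∘ₗ shift V H y) (ext_single ?_) ξ
  rintro ⟨φ, g⟩ a
  rw [LinearMap.comp_apply, LinearMap.comp_apply, coeff_single, shift_single, shift_single,
    coeff_single]
  congr 1
  simp only
  rw [← V.add_apply, neg_add_eq, V.add_apply, ← hV, ← mul_assoc, ← mul_assoc, apply_one_mul_apply hV,
    apply_mul_apply_one hV]

theorem shift_shiftInv (h : IsCompleteInteraction V H) (hV : IsCStarDynamicalSystem V)
    (y : PosCone Γ) (ξ : FellSpace V H) :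
    ‖shift V H y (shiftInv V H y ξ) - coeff V H (V y 1) ξ‖ = 0 := by
  refine norm_sub_eq_zero (S := shift V H y ∘ₗ shiftInv V H y) (fun i b => ?_) ξ
  obtain ⟨φ, k⟩ := i
  obtain ⟨g, rfl⟩ : ∃ g, k = y.1 + g := ⟨k - y.1, (add_sub_cancel _ _).symm⟩
  rw [LinearMap.comp_apply, shiftInv_single_add, shift_single, coeff_single, ← map_sub]
  refine norm_single_eq_zero (form_self_eq_zero h ?_)
  simp only
  rw [← V.add_apply, neg_add_eq, V.add_apply, hV, h.vh, ← mul_assoc, ← mul_assoc, apply_mul_apply_one hV,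
    pos_add, add_comm (pos g), mul_sub, sub_mul, sub_eq_zero]
  have hu : V (up y g) 1 * V (up y g + pos g) 1 = V (up y g + pos g) 1 :=
    apply_one_mul_apply_add hV _ _ _
  simp only [mul_assoc, hu]

theorem shiftInv_shift (h : IsCompleteInteraction V H) (hV : IsCStarDynamicalSystem V)
    (y : PosCone Γ) (ξ : FellSpace V H) :
    ‖shiftInv V H y (shift V H y ξ) - coeff V H (H y 1) ξ‖ = 0 := by
  refine norm_sub_eq_zero (S := shiftInv V H y ∘ₗ shift V H y) (fun i a => ?_) ξ
  obtain ⟨φ, g⟩ := i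
  have hc := Subring.mem_center_iff.mp (h.hasCentralUnits_iff.mpr hV (up y g))
  rw [LinearMap.comp_apply, shift_single, shiftInv_single_add, coeff_single, ← map_sub]
  refine norm_single_eq_zero (form_self_eq_zero h ?_)
  simp only
  rw [h.hv, hc, ← mul_assoc, h.isIdempotent, ← mul_assoc, ← neg_compress h, ← sub_mul]
  have e : V (neg g) 1 * (H (up y g) 1 * V (neg g) 1 - V (neg g) 1 * H (up y g) 1 * V (neg g) 1) =
      0 := by
    rw [mul_sub, ← mul_assoc, ← mul_assoc, ← mul_assoc, h.symm.isIdempotent, sub_self]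
  rw [← mul_assoc, e, zero_mul, zero_mul]

theorem coeff_one (h : IsCompleteInteraction V H) (ξ : FellSpace V H) :
    ‖coeff V H 1 ξ - ξ‖ = 0 := by
  refine norm_sub_eq_zero (T := LinearMap.id) (fun i a => ?_) ξ
  rw [LinearMap.id_apply, coeff_single, ← map_sub]
  refine norm_single_eq_zero (form_self_eq_zero h ?_)
  rw [mul_sub, ← mul_assoc, h.symm.isIdempotent, sub_self, zero_mul]

theorem coeff_mul (hV : IsCStarDynamicalSystem V) (c d : A) (ξ : FellSpace V H) :
    coeff V H (c * d) ξ = coeff V H c (coeff V H d ξ) :=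
  LinearMap.congr_fun (g := coeff V H c ∘ₗ coeff V H d) (ext_single fun i a => by
    rw [LinearMap.comp_apply, coeff_single, coeff_single, coeff_single, hV, mul_assoc]) ξ

/-- The regular representation of a complete interaction whose first action is multiplicative. -/
noncomputable def regular (h : IsCompleteInteraction V H) (hV : IsCStarDynamicalSystem V) :
    PreCovariantRepresentation V H (FellSpace V H) where
  π :=
    { toFun := coeff V H
      map_add' := fun c d => ext_single fun i a => by
        rw [LinearMap.add_apply, coeff_single, coeff_single, coeff_single, ← map_add, map_add (V _),
          add_mul]
      map_smul' := fun z c => ext_single fun i a => by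
        rw [RingHom.id_apply, LinearMap.smul_apply, coeff_single, coeff_single, ← map_smul,
          map_smul (V _), smul_mul_assoc] }
  u := shift V H
  u' := shiftInv V H
  π_mul := coeff_mul hV
  π_one := coeff_one h
  π_adj := coeff_adjoint hV
  π_faithful _ := coeff_faithful
  u_adj := shift_adjoint h hV
  u_add := shift_add hV
  u_π := shift_coeff hV
  u_u' := shift_shiftInv h hV
  u'_u := shiftInv_shift h hV

end FellSpace

theorem IsCompleteInteraction.finelyRepresentable {V H : PosAction Γ A}
    (h : IsCompleteInteraction V H) (hV : IsCStarDynamicalSystem V) :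
    FinelyRepresentable V ∧ FinelyRepresentable H :=
  ⟨⟨_, inferInstance, ⟨(FellSpace.regular h hV).toCovariant h hV⟩⟩,
    ⟨_, inferInstance, ⟨(FellSpace.regular h hV).toCovariant' h hV⟩⟩⟩

end Fell

theorem theorem4p3 {Γ : Type u} [AddCommGroup Γ] [LinearOrder Γ] [IsOrderedAddMonoid Γ]
    {A : Type v} [CStarAlgebra A] [PartialOrder A] [StarOrderedRing A]
    (V H : PosAction Γ A) (hVH : IsCompleteInteraction V H) :
    [ActsByEndomorphisms V, HasCentralUnits H, IsCStarDynamicalSystem V].TFAE ∧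
    [ActsByEndomorphisms H, HasCentralUnits V, IsCStarDynamicalSystem H].TFAE ∧
    ((ActsByEndomorphisms V ∨ HasCentralUnits H ∨ IsCStarDynamicalSystem V ∨
        ActsByEndomorphisms H ∨ HasCentralUnits V ∨ IsCStarDynamicalSystem H) →
      FinelyRepresentable V ∧ FinelyRepresentable H) := by
  refine ⟨hVH.tfae, hVH.symm.tfae, ?_⟩
  rintro (h | h | h | h | h | h)
  · exact hVH.finelyRepresentable (V.actsByEndomorphisms_iff.mp h)
  · exact hVH.finelyRepresentable (hVH.hasCentralUnits_iff.mp h)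
  · exact hVH.finelyRepresentable h
  · exact (hVH.symm.finelyRepresentable (H.actsByEndomorphisms_iff.mp h)).symm
  · exact (hVH.symm.finelyRepresentable (hVH.symm.hasCentralUnits_iff.mp h)).symm
  · exact (hVH.symm.finelyRepresentable h).symm
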